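/- Let $n\ge 0$ and let $m_1,\dots,m_n$ be natural numbers. A game of size $m_1\times\dots\times m_n$ has players $1,\dots,n$, where player $i$ has a set $S^i$ of $m_i$ pure strategies, and is given by utility functions $U^i : S\to\mathbb{R}$, where $S=S^1\times\dots\times S^n$; it is thus identified with a point of $(\mathbb{R}^{m_1\cdots m_n})^n$ with its usual topology. A correlated equilibrium of such a game is a probability distribution $\mu$ on $S$ such that, for every player $i$ and all $s^i,t^i\in S^i$, $$\sum_{s^{-i}\in\prod_{j\ne i}S^j}\mu(s^i,s^{-i})\,\bigl[U^i(s^i,s^{-i})-U^i(t^i,s^{-i})\bigr]\ \ge\ 0 .$$ Then: (a) The set of games of size $m_1\times\dots\times m_n$ with exactly one correlated equilibrium is open in $(\mathbb{R}^{m_1\cdots m_n})^n$. (b) If a game $G$ of size $m_1\times\dots\times m_n$ has a unique correlated equilibrium $\sigma$, then there is a neighbourhood of $G$ in $(\mathbb{R}^{m_1\cdots m_n})^n$ such that every game $\hat G$ in it has a unique correlated equilibrium $\hat\sigma$, and $\{s\in S:\hat\sigma(s)>0\}=\{s\in S:\sigma(s)>0\}$. -/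

import Mathlib

open Filter Topology

/-- Pure strategy profiles of a game of size `m 0 × ⋯ × m (n - 1)`. -/
abbrev Profile {n : ℕ} (m : Fin n → ℕ) : Type := (i : Fin n) → Fin (m i)

/-- An `n`-player game of size `m 0 × ⋯ × m (n - 1)`, identified with its payoffs:
`U i s` is the utility of player `i` at the profile `s`. The topology is the product
topology, i.e. the usual topology of the finite-dimensional payoff space. -/
abbrev Game {n : ℕ} (m : Fin n → ℕ) : Type := Fin n → Profile m → ℝ

/-- The linear form `h^{a,b}(μ) = ∑_{s^{-i}} μ(a, s^{-i}) [U^i(a, s^{-i}) - U^i(b, s^{-i})]`.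
The profiles `(a, s^{-i})` are exactly the profiles `s` with `s i = a`. -/
noncomputable def incentive {n : ℕ} {m : Fin n → ℕ} (U : Game m) (i : Fin n)
    (a b : Fin (m i)) (μ : Profile m → ℝ) : ℝ :=
  ∑ s : Profile m with s i = a, μ s * (U i s - U i (Function.update s i b))

/-- `μ` is a correlated equilibrium of `U`: a probability distribution on the set of pure
strategy profiles satisfying all incentive constraints. -/
def IsCorrelatedEquilibrium {n : ℕ} {m : Fin n → ℕ} (U : Game m)
    (μ : Profile m → ℝ) : Prop :=
  μ ∈ stdSimplex ℝ (Profile m) ∧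
    ∀ (i : Fin n) (a b : Fin (m i)), 0 ≤ incentive U i a b μ

/-- The set of profiles with positive probability under `μ`. -/
def profileSupport {n : ℕ} {m : Fin n → ℕ} (μ : Profile m → ℝ) : Set (Profile m) :=
  {s | 0 < μ s}

/-!
Call a constraint (incentive or nonnegativity) active if the unique equilibrium `σ` of `U`
satisfies it with equality. A vector of total mass zero that satisfies the active constraints is
zero, since `σ` could be moved a little in its direction. By compactness this persists in every
nearby game `V`, and there the inactive constraints hold strictly at all probability distributions
satisfying the active ones.

Stiemke's theorem gives positive weights on the active constraints with which their weighted sum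
vanishes. Reading the weights as transition rates between the strategies of each player, as Hart
and Schmeidler do, take a product of stationary distributions: its support is a product set,
contained in the support of `σ` and closed under active deviations. On such a set every game
admits a distribution satisfying the incentive constraints of the active deviations. Let `τ` be
one for `V` and `ρ` one for `-V`. If `μ` is `τ` or any equilibrium of `V`, then `μ - ρ` satisfies
the active constraints of `V` and has total mass zero, so `μ = ρ`.
-/

section Separation

variable {ι : Type*} [Fintype ι]

/-- The probability vectors on `ι` that vanish outside `R`, i.e. the face of the standard simplex
spanned by the vertices in `R`. For games, `R` is a set of allowed strategies or profiles. -/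
def stdSimplexFace (R : Set ι) : Set (ι → ℝ) :=
  stdSimplex ℝ ι ∩ {p | ∀ a ∉ R, p a = 0}

theorem isCompact_stdSimplexFace (R : Set ι) : IsCompact (stdSimplexFace R) := by
  refine (isCompact_stdSimplex ℝ ι).inter_right ?_
  simp only [Set.ofPred_forall]
  exact isClosed_biInter fun a _ => isClosed_eq (continuous_apply a) continuous_const

theorem convex_stdSimplexFace (R : Set ι) : Convex ℝ (stdSimplexFace R) := by
  refine (convex_stdSimplex ℝ ι).inter fun p hp q hq s t _ _ _ a ha => ?_
  simp [hp a ha, hq a ha]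

theorem stdSimplexFace_mono {R S : Set ι} (h : R ⊆ S) : stdSimplexFace R ⊆ stdSimplexFace S :=
  fun _ hp => ⟨hp.1, fun a ha => hp.2 a fun haR => ha (h haR)⟩

theorem single_mem_stdSimplexFace [DecidableEq ι] {R : Set ι} {a : ι} (ha : a ∈ R) :
    Pi.single a 1 ∈ stdSimplexFace R :=
  ⟨single_mem_stdSimplex ℝ a, fun _ hb => Pi.single_eq_of_ne (ne_of_mem_of_not_mem ha hb).symm 1⟩

theorem exists_dotProduct_separation {K : Set (ι → ℝ)} (hconv : Convex ℝ K) (hcomp : IsCompact K)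
    (C : ProperCone ℝ (ι → ℝ)) (hKC : Disjoint K C) :
    ∃ w : ι → ℝ, (∀ y ∈ C, 0 ≤ w ⬝ᵥ y) ∧ ∀ y ∈ K, w ⬝ᵥ y < 0 := by
  classical
  obtain ⟨f, hfC, hfK⟩ := C.hyperplane_separation hconv hcomp hKC
  obtain ⟨w, hw⟩ := (dotProductEquiv ℝ ι).surjective f.toLinearMap
  have hf (y : ι → ℝ) : w ⬝ᵥ y = f y := LinearMap.congr_fun hw y
  exact ⟨w, by simpa only [hf] using hfC, by simpa only [hf] using hfK⟩

theorem exists_mem_nonneg_on_of_forall_weights {K : Set (ι → ℝ)} (hconv : Convex ℝ K)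
    (hcomp : IsCompact K) (S : Set ι)
    (h : ∀ w : ι → ℝ, (∀ j, 0 ≤ w j) → (∀ j ∉ S, w j = 0) → ∃ y ∈ K, 0 ≤ w ⬝ᵥ y) :
    ∃ y ∈ K, ∀ j ∈ S, 0 ≤ y j := by
  classical
  let C : ProperCone ℝ (ι → ℝ) :=
    { toSubmodule := Submodule.pi S fun _ => PointedCone.positive ℝ ℝ
      isClosed' := isClosed_set_pi fun _ _ => isClosed_Ici }
  have mem_C {y : ι → ℝ} : y ∈ C ↔ ∀ j ∈ S, 0 ≤ y j := Iff.rfl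
  by_contra! hK
  obtain ⟨w, hwC, hwK⟩ := exists_dotProduct_separation hconv hcomp C <|
    Set.disjoint_left.2 fun y hy hyC => by
      obtain ⟨j, hj, hlt⟩ := hK y hy
      exact hlt.not_ge (mem_C.1 hyC j hj)
  have hw (j : ι) : 0 ≤ w j := by
    simpa using hwC (Pi.single j 1) (mem_C.2 fun k _ => by
      rw [Pi.single_apply]; positivity)
  have hw_off (j : ι) (hj : j ∉ S) : w j = 0 := by
    refine le_antisymm ?_ (hw j)
    simpa using hwC (-Pi.single j 1) (mem_C.2 fun k hk => by
      simp [Pi.single_eq_of_ne (ne_of_mem_of_not_mem hk hj)])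
  obtain ⟨y, hy, hwy⟩ := h w hw hw_off
  exact (hwK y hy).not_ge hwy

theorem stiemke_exists_pos_on (M : Submodule ℝ (ι → ℝ)) (S : Set ι)
    (h : ∀ y ∈ M, (∀ j ∈ S, 0 ≤ y j) → ∀ j ∈ S, y j = 0) :
    ∃ w : ι → ℝ, (∀ j ∈ S, 0 < w j) ∧ (∀ j ∉ S, w j = 0) ∧ ∀ y ∈ M, w ⬝ᵥ y = 0 := by
  classical
  -- Adding to `M` all vectors supported off `S` forces `w` to vanish there.
  let M' : Submodule ℝ (ι → ℝ) := M ⊔ Submodule.pi S fun _ => ⊥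
  let C : ProperCone ℝ (ι → ℝ) :=
    { toSubmodule := M'.restrictScalars _
      isClosed' := M'.closed_of_finiteDimensional }
  obtain ⟨w, hwC, hwK⟩ := exists_dotProduct_separation (convex_stdSimplexFace S)
    (isCompact_stdSimplexFace S) C <| Set.disjoint_left.2 <| by
      rintro y ⟨⟨hy0, hy1⟩, hyS⟩ hyM
      obtain ⟨x, hx, z, hz, rfl⟩ := Submodule.mem_sup.1 hyM
      have hxz : ∀ j ∈ S, (x + z) j = x j := fun j hj => by simpa using hz j hj
      have hx0 := h x hx fun j hj => hxz j hj ▸ hy0 j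
      have hsum : ∑ j, (x + z) j = 0 := Finset.sum_eq_zero fun j _ => by
        by_cases hj : j ∈ S
        · rw [hxz j hj, hx0 j hj]
        · exact hyS j hj
      exact one_ne_zero (hy1.symm.trans hsum)
  have hw (y : ι → ℝ) (hy : y ∈ M') : w ⬝ᵥ y = 0 :=
    le_antisymm (by simpa using hwC (-y) (M'.neg_mem hy)) (hwC y hy)
  refine ⟨-w, fun j hj => ?_, fun j hj => ?_, fun y hy => ?_⟩
  · simpa using hwK _ (single_mem_stdSimplexFace hj)
  · have hmem : Pi.single j 1 ∈ M' := Submodule.mem_sup_right fun k hk =>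
      Pi.single_eq_of_ne (ne_of_mem_of_not_mem hk hj) 1
    simpa using hw _ hmem
  · simpa using hw y (Submodule.mem_sup_left hy)

end Separation

section Stationary

open Matrix

variable {ι : Type*} [Fintype ι] [DecidableEq ι]

/-- The generator of the continuous-time Markov chain with jump rates `α`; the stationary
distributions are its left null vectors. The diagonal of `α` cancels. -/
def markovGenerator (α : Matrix ι ι ℝ) : Matrix ι ι ℝ :=
  α - diagonal fun a => ∑ b, α a b

theorem markovGenerator_mulVec_apply (α : Matrix ι ι ℝ) (v : ι → ℝ) (a : ι) :
    (markovGenerator α *ᵥ v) a = ∑ b, α a b * (v b - v a) := by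
  rw [markovGenerator, sub_mulVec, Pi.sub_apply, mulVec_diagonal, Finset.sum_mul]
  simp only [mulVec, dotProduct, mul_sub, Finset.sum_sub_distrib]

theorem vecMul_markovGenerator_apply (α : Matrix ι ι ℝ) (p : ι → ℝ) (b : ι) :
    (p ᵥ* markovGenerator α) b = ∑ a, p a * α a b - p b * ∑ c, α b c := by
  rw [markovGenerator, vecMul_sub, Pi.sub_apply, vecMul_diagonal]
  rfl

theorem exists_stationary {α : Matrix ι ι ℝ} (hα : ∀ a b, 0 ≤ α a b) {R : Set ι}
    (hR : R.Nonempty) (hcl : ∀ a ∈ R, ∀ b, 0 < α a b → b ∈ R) :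
    ∃ p ∈ stdSimplexFace R, p ᵥ* markovGenerator α = 0 := by
  have hweights (w : ι → ℝ) :
      ∃ y ∈ (markovGenerator α).vecMulLinear '' stdSimplexFace R, 0 ≤ w ⬝ᵥ y := by
    obtain ⟨a, ha, hmin⟩ := Set.exists_min_image R w R.toFinite hR
    refine ⟨_, Set.mem_image_of_mem _ (single_mem_stdSimplexFace ha), ?_⟩
    rw [vecMulLinear_apply, dotProduct_comm, ← dotProduct_mulVec, single_one_dotProduct,
      markovGenerator_mulVec_apply]
    refine Finset.sum_nonneg fun b _ => ?_
    rcases (hα a b).eq_or_lt with hab | hab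
    · simp [← hab]
    · exact mul_nonneg hab.le (sub_nonneg.2 (hmin b (hcl a ha b hab)))
  obtain ⟨_, ⟨p, hp, rfl⟩, hnonneg⟩ := exists_mem_nonneg_on_of_forall_weights
    ((convex_stdSimplexFace R).linear_image (markovGenerator α).vecMulLinear)
    ((isCompact_stdSimplexFace R).image (LinearMap.continuous_of_finiteDimensional _))
    Set.univ fun w _ _ => hweights w
  have hsum : ∑ b, (p ᵥ* markovGenerator α) b = 0 := by
    rw [← dotProduct_one, ← dotProduct_mulVec]
    convert dotProduct_zero p
    ext a
    simp [markovGenerator_mulVec_apply]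
  refine ⟨p, hp, funext fun b => ?_⟩
  exact (Finset.sum_eq_zero_iff_of_nonneg fun b _ => hnonneg b trivial).1 hsum b
    (Finset.mem_univ b)

theorem pos_of_stationary {α : Matrix ι ι ℝ} (hα : ∀ a b, 0 ≤ α a b) {p : ι → ℝ}
    (hp : ∀ a, 0 ≤ p a) (hst : p ᵥ* markovGenerator α = 0) {a b : ι} (ha : 0 < p a)
    (hab : 0 < α a b) : 0 < p b := by
  refine (hp b).lt_of_ne fun hb => ?_
  have hinflow : ∑ c, p c * α c b = 0 := by
    simpa [vecMul_markovGenerator_apply, ← hb] using congrFun hst b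
  refine (mul_pos ha hab).ne' ?_
  exact (Finset.sum_eq_zero_iff_of_nonneg fun c _ => mul_nonneg (hp c) (hα c b)).1 hinflow a
    (Finset.mem_univ a)

theorem sum_mul_sub_eq_zero_of_stationary {α : Matrix ι ι ℝ} {p : ι → ℝ}
    (hst : p ᵥ* markovGenerator α = 0) (v : ι → ℝ) :
    ∑ a, ∑ b, α a b * (p a * (v a - v b)) = 0 := by
  calc ∑ a, ∑ b, α a b * (p a * (v a - v b)) = -(p ⬝ᵥ markovGenerator α *ᵥ v) := by
        simp only [dotProduct, markovGenerator_mulVec_apply, Finset.mul_sum,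
          ← Finset.sum_neg_distrib]
        exact Finset.sum_congr rfl fun a _ => Finset.sum_congr rfl fun b _ => by ring
    _ = 0 := by rw [dotProduct_mulVec, hst, zero_dotProduct, neg_zero]

end Stationary

theorem eventually_nonneg_add_smul {ι : Type*} [Finite ι] {x y : ι → ℝ} (hx : ∀ j, 0 ≤ x j)
    (hy : ∀ j, x j = 0 → 0 ≤ y j) : ∀ᶠ t : ℝ in 𝓝[>] 0, ∀ j, 0 ≤ (x + t • y) j := by
  refine eventually_all.2 fun j => ?_
  rcases (hx j).eq_or_lt with hj | hj
  · filter_upwards [self_mem_nhdsWithin] with t (ht : 0 < t)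
    simpa [← hj] using mul_nonneg ht.le (hy j hj.symm)
  · have hlim : Tendsto (fun t : ℝ => (x + t • y) j) (𝓝[>] 0) (𝓝 (x j)) := by
      refine Tendsto.mono_left ?_ nhdsWithin_le_nhds
      exact Continuous.tendsto' (by fun_prop) _ _ (by simp)
    exact (hlim.eventually (lt_mem_nhds hj)).mono fun t ht => ht.le

section Games

variable {n : ℕ} {m : Fin n → ℕ}

/-- The distribution of the profile when the players mix independently, player `i` by `p i`. -/
def productDistribution (p : ∀ i, Fin (m i) → ℝ) (s : Profile m) : ℝ :=
  ∏ i, p i (s i)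

theorem productDistribution_mem_stdSimplexFace {p : ∀ i, Fin (m i) → ℝ}
    {R : ∀ i, Set (Fin (m i))} (hp : ∀ i, p i ∈ stdSimplexFace (R i)) :
    productDistribution p ∈ stdSimplexFace (Set.univ.pi R) := by
  refine ⟨⟨fun s => Finset.prod_nonneg fun i _ => (hp i).1.1 _, ?_⟩, fun s hs => ?_⟩
  · simp only [productDistribution, ← Fintype.prod_sum, (hp _).1.2, Finset.prod_const_one]
  · obtain ⟨i, hi⟩ : ∃ i, s i ∉ R i := by simpa [Set.mem_univ_pi] using hs
    exact Finset.prod_eq_zero (Finset.mem_univ i) ((hp i).2 _ hi)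

/-- The expected payoff of player `i` for the pure strategy `a` when the other players mix
according to `p`. -/
def purePayoff (U : Game m) (p : ∀ i, Fin (m i) → ℝ) (i : Fin n) (a : Fin (m i)) : ℝ :=
  ∑ s : Profile m with s i = a, (∏ j ∈ Finset.univ.erase i, p j (s j)) * U i s

theorem sum_mul_update_eq_purePayoff (U : Game m) (p : ∀ i, Fin (m i) → ℝ) (i : Fin n)
    (a b : Fin (m i)) :
    ∑ s : Profile m with s i = a,
      (∏ j ∈ Finset.univ.erase i, p j (s j)) * U i (Function.update s i b) =
        purePayoff U p i b := by
  refine Finset.sum_nbij' (Function.update · i b) (Function.update · i a) ?_ ?_ ?_ ?_ ?_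
  · simp
  · simp
  · rintro s hs
    simp [← (Finset.mem_filter.1 hs).2]
  · rintro s hs
    simp [← (Finset.mem_filter.1 hs).2]
  · intro s _
    congr 1
    refine Finset.prod_congr rfl fun j hj => ?_
    rw [Function.update_of_ne (Finset.ne_of_mem_erase hj)]

theorem incentive_productDistribution (U : Game m) (p : ∀ i, Fin (m i) → ℝ) (i : Fin n)
    (a b : Fin (m i)) :
    incentive U i a b (productDistribution p) =
      p i a * (purePayoff U p i a - purePayoff U p i b) := by
  rw [← sum_mul_update_eq_purePayoff U p i a b, purePayoff, ← Finset.sum_sub_distrib,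
    Finset.mul_sum, incentive]
  refine Finset.sum_congr rfl fun s hs => ?_
  rw [productDistribution, ← Finset.mul_prod_erase _ _ (Finset.mem_univ i),
    (Finset.mem_filter.1 hs).2]
  ring

/-- The triples `⟨i, a, b⟩` of a player, a recommended strategy and a strategy to play instead.
They index the incentive constraints. -/
abbrev Deviation (m : Fin n → ℕ) : Type := Σ i : Fin n, Fin (m i) × Fin (m i)

/-- `R` contains all strategies reached from its own by the deviations in `D`. -/
def IsClosedUnderDeviations (D : Set (Deviation m)) (R : ∀ i, Set (Fin (m i))) : Prop :=
  ∀ i, ∀ a ∈ R i, ∀ b, ⟨i, a, b⟩ ∈ D → b ∈ R i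

/-- The left-hand sides of the incentive constraints as a linear map. -/
noncomputable def incentiveMap (U : Game m) : (Profile m → ℝ) →ₗ[ℝ] (Deviation m → ℝ) where
  toFun μ d := incentive U d.1 d.2.1 d.2.2 μ
  map_add' μ ν := by
    ext d
    simp only [incentive, Pi.add_apply, add_mul, Finset.sum_add_distrib]
  map_smul' r μ := by
    ext d
    simp only [incentive, Pi.smul_apply, smul_eq_mul, RingHom.id_apply, mul_assoc, Finset.mul_sum]

theorem incentiveMap_neg (U : Game m) : incentiveMap (-U) = -incentiveMap U := by
  refine LinearMap.ext fun μ => funext fun d => ?_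
  simp only [incentiveMap, incentive, LinearMap.coe_mk, AddHom.coe_mk, LinearMap.neg_apply,
    Pi.neg_apply, ← Finset.sum_neg_distrib]
  exact Finset.sum_congr rfl fun s _ => by ring

/-- The jump rates that `w` assigns to the deviations of player `i`. -/
def deviationRates (w : Deviation m → ℝ) (i : Fin n) : Matrix (Fin (m i)) (Fin (m i)) ℝ :=
  Matrix.of fun a b => w ⟨i, a, b⟩

open Matrix in
theorem dotProduct_incentiveMap_productDistribution {w : Deviation m → ℝ}
    {p : ∀ i, Fin (m i) → ℝ} (hst : ∀ i, p i ᵥ* markovGenerator (deviationRates w i) = 0)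
    (U : Game m) : w ⬝ᵥ incentiveMap U (productDistribution p) = 0 := by
  simp only [dotProduct, Fintype.sum_sigma, Fintype.sum_prod_type, incentiveMap, LinearMap.coe_mk,
    AddHom.coe_mk, incentive_productDistribution]
  exact Finset.sum_eq_zero fun i _ => sum_mul_sub_eq_zero_of_stationary (hst i) _

/-- When `D` and all `R i` are full, this is the Hart–Schmeidler theorem that correlated equilibria
exist. -/
theorem exists_mem_stdSimplexFace_incentiveMap_nonneg (U : Game m) {D : Set (Deviation m)}
    {R : ∀ i, Set (Fin (m i))} (hR : ∀ i, (R i).Nonempty) (hcl : IsClosedUnderDeviations D R) :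
    ∃ μ ∈ stdSimplexFace (Set.univ.pi R), ∀ d ∈ D, 0 ≤ incentiveMap U μ d := by
  have hweights (w : Deviation m → ℝ) (hw : ∀ d, 0 ≤ w d) (hwD : ∀ d ∉ D, w d = 0) :
      ∃ y ∈ incentiveMap U '' stdSimplexFace (Set.univ.pi R), 0 ≤ w ⬝ᵥ y := by
    have hclw (i : Fin n) (a) (ha : a ∈ R i) (b) (hab : 0 < deviationRates w i a b) : b ∈ R i :=
      hcl i a ha b (by_contra fun hD => hab.ne' (hwD _ hD))
    choose p hp hst using fun i => exists_stationary (fun a b => hw ⟨i, a, b⟩) (hR i) (hclw i)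
    exact ⟨_, Set.mem_image_of_mem _ (productDistribution_mem_stdSimplexFace hp),
      (dotProduct_incentiveMap_productDistribution hst U).ge⟩
  obtain ⟨_, ⟨μ, hμ, rfl⟩, hnonneg⟩ := exists_mem_nonneg_on_of_forall_weights
    ((convex_stdSimplexFace _).linear_image (incentiveMap U))
    ((isCompact_stdSimplexFace _).image (LinearMap.continuous_of_finiteDimensional _)) D hweights
  exact ⟨μ, hμ, hnonneg⟩

/-- The left-hand sides of all the linear inequalities that cut the correlated equilibria out of
the vectors of total mass one: the incentive constraints and the nonnegativity constraints. -/
noncomputable def constraintMap (U : Game m) :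
    (Profile m → ℝ) →ₗ[ℝ] (Deviation m ⊕ Profile m → ℝ) :=
  (LinearEquiv.sumArrowLequivProdArrow _ _ ℝ ℝ).symm.toLinearMap ∘ₗ
    (incentiveMap U).prod LinearMap.id

@[simp]
theorem constraintMap_inl (U : Game m) (μ : Profile m → ℝ) (d : Deviation m) :
    constraintMap U μ (Sum.inl d) = incentiveMap U μ d := rfl

@[simp]
theorem constraintMap_inr (U : Game m) (μ : Profile m → ℝ) (s : Profile m) :
    constraintMap U μ (Sum.inr s) = μ s := rfl

theorem isCorrelatedEquilibrium_iff {U : Game m} {μ : Profile m → ℝ} :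
    IsCorrelatedEquilibrium U μ ↔ ∑ s, μ s = 1 ∧ ∀ j, 0 ≤ constraintMap U μ j := by
  constructor
  · rintro ⟨⟨hnonneg, hsum⟩, hinc⟩
    exact ⟨hsum, Sum.rec (fun d => hinc d.1 d.2.1 d.2.2) hnonneg⟩
  · rintro ⟨hsum, hnonneg⟩
    exact ⟨⟨fun s => hnonneg (Sum.inr s), hsum⟩, fun i a b => hnonneg (Sum.inl ⟨i, a, b⟩)⟩

theorem continuous_constraintMap_apply (j : Deviation m ⊕ Profile m) :
    Continuous fun x : Game m × (Profile m → ℝ) => constraintMap x.1 x.2 j := by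
  rcases j with d | s
  · simp only [constraintMap_inl, incentiveMap, LinearMap.coe_mk, AddHom.coe_mk, incentive]
    fun_prop
  · simp only [constraintMap_inr]
    fun_prop

/-- The vectors satisfying the constraints of `U` in `A`. -/
def constraintCone (A : Set (Deviation m ⊕ Profile m)) (U : Game m) : Set (Profile m → ℝ) :=
  {ν | ∀ j ∈ A, 0 ≤ constraintMap U ν j}

theorem isClosed_graph_constraintCone (A : Set (Deviation m ⊕ Profile m)) :
    IsClosed {x : Game m × (Profile m → ℝ) | x.2 ∈ constraintCone A x.1} := by
  have hinter : {x : Game m × (Profile m → ℝ) | x.2 ∈ constraintCone A x.1} =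
      ⋂ j ∈ A, {x | 0 ≤ constraintMap x.1 x.2 j} := by
    ext x
    simp [constraintCone]
  rw [hinter]
  exact isClosed_biInter fun j _ => isClosed_Ici.preimage (continuous_constraintMap_apply j)

theorem eventually_forall_mem_constraintCone {A : Set (Deviation m ⊕ Profile m)} {U : Game m}
    {K : Set (Profile m → ℝ)} (hK : IsCompact K) {P : Game m → (Profile m → ℝ) → Prop}
    (hP : ∀ ν ∈ K, ν ∈ constraintCone A U → ∀ᶠ x in 𝓝 (U, ν), P x.1 x.2) :
    ∀ᶠ V in 𝓝 U, ∀ ν ∈ K, ν ∈ constraintCone A V → P V ν := by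
  refine hK.eventually_forall_of_forall_eventually fun ν hν => ?_
  by_cases hmem : ν ∈ constraintCone A U
  · exact (hP ν hν hmem).mono fun x hx _ => hx
  · filter_upwards [(isClosed_graph_constraintCone A).isOpen_compl.mem_nhds hmem] with x hx hx'
    exact absurd hx' hx

/-- `σ` is the only correlated equilibrium of `U`. -/
def IsUniqueCorrelatedEquilibrium (U : Game m) (σ : Profile m → ℝ) : Prop :=
  IsCorrelatedEquilibrium U σ ∧ ∀ μ, IsCorrelatedEquilibrium U μ → μ = σ

/-- The constraints of `U` that hold with equality at `σ`. -/
def activeConstraints (U : Game m) (σ : Profile m → ℝ) : Set (Deviation m ⊕ Profile m) :=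
  {j | constraintMap U σ j = 0}

namespace IsUniqueCorrelatedEquilibrium

variable {U : Game m} {σ ν : Profile m → ℝ}

theorem eq_zero_of_mem_constraintCone (hσ : IsUniqueCorrelatedEquilibrium U σ)
    (hν : ν ∈ constraintCone (activeConstraints U σ) U) (hmass : ∑ s, ν s = 0) : ν = 0 := by
  obtain ⟨hσ1, hσ0⟩ := isCorrelatedEquilibrium_iff.1 hσ.1
  obtain ⟨t, ht, htpos⟩ : ∃ t : ℝ, (∀ j, 0 ≤ constraintMap U (σ + t • ν) j) ∧ 0 < t := by
    simpa only [map_add, map_smul] using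
      ((eventually_nonneg_add_smul hσ0 hν).and self_mem_nhdsWithin).exists
  have hsum : ∑ s, (σ + t • ν) s = 1 := by
    simp [Finset.sum_add_distrib, ← Finset.mul_sum, hmass, hσ1]
  have heq : σ + t • ν = σ := hσ.2 _ (isCorrelatedEquilibrium_iff.2 ⟨hsum, ht⟩)
  simpa [htpos.ne'] using heq

theorem eq_smul_of_mem_constraintCone (hσ : IsUniqueCorrelatedEquilibrium U σ)
    (hν : ν ∈ constraintCone (activeConstraints U σ) U) : ν = (∑ s, ν s) • σ := by
  refine sub_eq_zero.1 (hσ.eq_zero_of_mem_constraintCone (fun j hj => ?_) ?_)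
  · have hj' : constraintMap U σ j = 0 := hj
    simpa [hj'] using hν j hj
  · simp [← Finset.mul_sum, hσ.1.1.2]

open Matrix in
theorem exists_weights_activeConstraints (hσ : IsUniqueCorrelatedEquilibrium U σ) :
    ∃ w : Deviation m ⊕ Profile m → ℝ, (∀ j, 0 ≤ w j) ∧ (∀ j ∈ activeConstraints U σ, 0 < w j) ∧
      ∀ ν, w ⬝ᵥ constraintMap U ν = 0 := by
  obtain ⟨w, hpos, hzero, hsum⟩ := stiemke_exists_pos_on (constraintMap U).range
    (activeConstraints U σ) <| by
      rintro _ ⟨ν, rfl⟩ hν j hj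
      have hj' : constraintMap U σ j = 0 := hj
      rw [hσ.eq_smul_of_mem_constraintCone hν]
      simp [hj']
  refine ⟨w, fun j => ?_, hpos, fun ν => hsum _ (LinearMap.mem_range_self _ ν)⟩
  by_cases hj : j ∈ activeConstraints U σ
  · exact (hpos j hj).le
  · exact (hzero j hj).ge

theorem exists_closed_product_subset_support (hσ : IsUniqueCorrelatedEquilibrium U σ) :
    ∃ R : ∀ i, Set (Fin (m i)), (∀ i, (R i).Nonempty) ∧
      IsClosedUnderDeviations (Sum.inl ⁻¹' activeConstraints U σ) R ∧
      Set.univ.pi R ⊆ profileSupport σ := by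
  obtain ⟨w, hw, hpos, hsum⟩ := hσ.exists_weights_activeConstraints
  obtain ⟨s₀⟩ : Nonempty (Profile m) := by
    by_contra! h
    simpa using hσ.1.1.2
  choose p hp hst using fun i => exists_stationary (fun a b => hw (Sum.inl ⟨i, a, b⟩))
    ⟨s₀ i, Set.mem_univ _⟩ fun _ _ _ _ => Set.mem_univ _
  have hp0 (i a) : 0 ≤ p i a := (hp i).1.1 a
  have hweight : ∑ s, w (Sum.inr s) * productDistribution p s = 0 := by
    simpa [dotProduct, Fintype.sum_sum_type,
      ← dotProduct_incentiveMap_productDistribution (w := fun d => w (Sum.inl d)) hst U] using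
      hsum (productDistribution p)
  refine ⟨fun i => {a | 0 < p i a}, fun i => ?_, fun i a ha b hab => ?_, fun s hs => ?_⟩
  · obtain ⟨a, -, ha⟩ := Finset.exists_lt_of_sum_lt (s := Finset.univ) (f := 0) (g := p i)
      (by simp [(hp i).1.2])
    exact ⟨a, ha⟩
  · exact pos_of_stationary (fun a b => hw (Sum.inl ⟨i, a, b⟩)) (hp0 i) (hst i) ha
      (hpos (Sum.inl ⟨i, a, b⟩) hab)
  · refine (hσ.1.1.1 s).lt_of_ne' fun hσs => ?_
    have hs0 := (Finset.sum_eq_zero_iff_of_nonneg fun s _ => mul_nonneg (hw _)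
      (Finset.prod_nonneg fun i _ => hp0 i (s i))).1 hweight s (Finset.mem_univ s)
    exact (mul_pos (hpos (Sum.inr s) hσs)
      (Finset.prod_pos fun i _ => hs i (Set.mem_univ i))).ne' hs0

theorem exists_mem_stdSimplexFace_profileSupport (hσ : IsUniqueCorrelatedEquilibrium U σ)
    (V : Game m) : ∃ μ ∈ stdSimplexFace (profileSupport σ),
      ∀ d, Sum.inl d ∈ activeConstraints U σ → 0 ≤ incentiveMap V μ d := by
  obtain ⟨R, hR, hcl, hsupp⟩ := hσ.exists_closed_product_subset_support
  obtain ⟨μ, hμ, hinc⟩ := exists_mem_stdSimplexFace_incentiveMap_nonneg V hR hcl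
  exact ⟨μ, stdSimplexFace_mono hsupp hμ, hinc⟩

theorem eventually_eq_zero_of_mem_constraintCone (hσ : IsUniqueCorrelatedEquilibrium U σ) :
    ∀ᶠ V in 𝓝 U, ∀ ν ∈ constraintCone (activeConstraints U σ) V, ∑ s, ν s = 0 → ν = 0 := by
  have hK : IsCompact (Metric.sphere (0 : Profile m → ℝ) 1 ∩ {ν | ∑ s, ν s = 0}) :=
    (isCompact_sphere 0 1).inter_right (isClosed_eq (by fun_prop) continuous_const)
  have hsphere := eventually_forall_mem_constraintCone (A := activeConstraints U σ) (U := U) hK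
    (P := fun _ _ => False) fun ν ⟨hν, hmass⟩ hmem => by
      simp [hσ.eq_zero_of_mem_constraintCone hmem hmass] at hν
  filter_upwards [hsphere] with V hV ν hν hmass
  by_contra hne
  have hnorm : 0 < ‖ν‖ := norm_pos_iff.2 hne
  refine hV (‖ν‖⁻¹ • ν) ⟨by simp [norm_smul, hnorm.ne'], ?_⟩ fun j hj => ?_
  · simp [← Finset.mul_sum, hmass]
  · simpa using mul_nonneg (inv_nonneg.2 hnorm.le) (hν j hj)

theorem eventually_constraintMap_pos (hσ : IsUniqueCorrelatedEquilibrium U σ) :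
    ∀ᶠ V in 𝓝 U, ∀ μ ∈ stdSimplex ℝ (Profile m), μ ∈ constraintCone (activeConstraints U σ) V →
      ∀ j ∉ activeConstraints U σ, 0 < constraintMap V μ j := by
  refine eventually_forall_mem_constraintCone (isCompact_stdSimplex ℝ _) fun μ hμ hmem => ?_
  obtain rfl : μ = σ := by
    rw [hσ.eq_smul_of_mem_constraintCone hmem, hμ.2, one_smul]
  refine eventually_all.2 fun j => eventually_imp_distrib_left.2 fun hj => ?_
  have hpos : 0 < constraintMap U μ j :=
    ((isCorrelatedEquilibrium_iff.1 hσ.1).2 j).lt_of_ne' hj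
  exact (continuous_constraintMap_apply j).continuousAt.eventually (lt_mem_nhds hpos)

theorem eventually_exists_support_eq (hσ : IsUniqueCorrelatedEquilibrium U σ) :
    ∀ᶠ V in 𝓝 U, ∃ τ, IsUniqueCorrelatedEquilibrium V τ ∧
      profileSupport τ = profileSupport σ := by
  filter_upwards [hσ.eventually_eq_zero_of_mem_constraintCone, hσ.eventually_constraintMap_pos]
    with V hzero hstrict
  obtain ⟨τ, hτ, hτinc⟩ := hσ.exists_mem_stdSimplexFace_profileSupport V
  obtain ⟨ρ, hρ, hρinc⟩ := hσ.exists_mem_stdSimplexFace_profileSupport (-V)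
  have hτcone : τ ∈ constraintCone (activeConstraints U σ) V :=
    Sum.rec hτinc fun s _ => hτ.1.1 s
  have eq_ρ {μ : Profile m → ℝ} (hμ : μ ∈ stdSimplex ℝ (Profile m))
      (hμcone : μ ∈ constraintCone (activeConstraints U σ) V) : μ = ρ := by
    refine sub_eq_zero.1 (hzero _ ?_ ?_)
    · rintro (d | s) hj
      · have hd : 0 ≤ -incentiveMap V ρ d := by simpa [incentiveMap_neg] using hρinc d hj
        simpa [sub_eq_add_neg] using add_nonneg (hμcone (Sum.inl d) hj) hd
      · have hσs : σ s = 0 := hj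
        have hρs : ρ s = 0 := hρ.2 s (by simp [profileSupport, hσs])
        simpa [hρs] using hμ.1 s
    · simp [hμ.2, hρ.1.2]
  have hτeq : τ = ρ := eq_ρ hτ.1 hτcone
  refine ⟨τ, ⟨isCorrelatedEquilibrium_iff.2 ⟨hτ.1.2, fun j => ?_⟩, fun μ hμ => ?_⟩, ?_⟩
  · by_cases hj : j ∈ activeConstraints U σ
    · exact hτcone j hj
    · exact (hstrict τ hτ.1 hτcone j hj).le
  · exact hτeq ▸ eq_ρ hμ.1 fun j _ => (isCorrelatedEquilibrium_iff.1 hμ).2 j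
  · ext s
    refine ⟨fun hs : 0 < τ s => ?_, fun hs : 0 < σ s => ?_⟩
    · exact by_contra fun hσs => hs.ne' (hτ.2 s hσs)
    · exact hstrict τ hτ.1 hτcone (Sum.inr s) hs.ne'

end IsUniqueCorrelatedEquilibrium

end Games

theorem proposition1 (n : ℕ) (m : Fin n → ℕ) :
    IsOpen {U : Game m | ∃! μ : Profile m → ℝ, IsCorrelatedEquilibrium U μ} ∧
    ∀ (U : Game m) (σ : Profile m → ℝ),
      IsCorrelatedEquilibrium U σ →
      (∀ μ : Profile m → ℝ, IsCorrelatedEquilibrium U μ → μ = σ) →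
      ∀ᶠ V in 𝓝 U, ∃ τ : Profile m → ℝ,
        IsCorrelatedEquilibrium V τ ∧
        (∀ μ : Profile m → ℝ, IsCorrelatedEquilibrium V μ → μ = τ) ∧
        profileSupport τ = profileSupport σ := by
  have stable {U : Game m} {σ} (hσ : IsUniqueCorrelatedEquilibrium U σ) :=
    hσ.eventually_exists_support_eq
  refine ⟨isOpen_iff_eventually.2 fun U ⟨σ, hσ⟩ => ?_, fun U σ hσ huniq => ?_⟩
  · filter_upwards [stable hσ] with V ⟨τ, hτ, _⟩
    exact ⟨τ, hτ⟩
  · filter_upwards [stable ⟨hσ, huniq⟩] with V ⟨τ, ⟨hτ, hτuniq⟩, hsupp⟩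
    exact ⟨τ, hτ, hτuniq, hsupp⟩
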